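/- Let $p$ be a prime, let $K$ be a finite field of characteristic $p$, and let $V$ be a finite-dimensional vector space over $K$ equipped with one of the following forms $f$: a nondegenerate alternating bilinear form, a nondegenerate Hermitian form (with respect to an automorphism of $K$ of order two), or a nondegenerate quadratic form. (A quadratic form $Q$ is nondegenerate if no nonzero singular vector lies in the radical of its polar form $Q(x+y)-Q(x)-Q(y)$; over a finite field that radical then has dimension at most one.) The associated finite classical polar space $\mathcal{P}$ consists of the subspaces of $V$ that are totally isotropic (for an alternating or Hermitian form) or totally singular (for a quadratic form). Its rank $r$ is the largest vector space dimension of such a subspace, its generators are its elements of dimension $r$, and its points are its elements of dimension one. A $2$-ovoid of $\mathcal{P}$ is a set of points of $\mathcal{P}$ such that every generator contains exactly two points of the set. Suppose that either $p \geq 5$ and $r \geq (1+\log_p 7)\,p + 1$, or $p \in \{2,3\}$ and $r \geq 6$. Then $\mathcal{P}$ has no $2$-ovoid. -/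

import Mathlib

/-- A form on the `K`-vector space `V` that defines a classical polar space: a nondegenerate
alternating bilinear form (symplectic spaces), a nondegenerate Hermitian form with respect to an
involutory field automorphism `σ ≠ 1` (Hermitian spaces), or a nondegenerate quadratic form
(elliptic, parabolic and hyperbolic quadrics). In characteristic `2` nondegeneracy of a quadratic
form allows its polar form to have a one-dimensional radical on which the quadratic form does not
vanish. -/
inductive ClassicalForm (K V : Type*) [Field K] [AddCommGroup V] [Module K V] where
  | symplectic (B : LinearMap.BilinForm K V) (alt : B.IsAlt) (nondeg : B.Nondegenerate)
  | hermitian (σ : K →+* K) (invol : ∀ a, σ (σ a) = a) (ne_id : σ ≠ RingHom.id K)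
      (B : V →ₛₗ[σ] V →ₗ[K] K) (symm : B.IsSymm) (nondeg : B.Nondegenerate)
  | orthogonal (Q : QuadraticForm K V) (nondeg : Q.Nondegenerate)

namespace ClassicalForm

variable {K V : Type*} [Field K] [AddCommGroup V] [Module K V]

/-- `W` is an element of the polar space of `f`: a totally isotropic subspace (for a sesquilinear
form) or a totally singular subspace (for a quadratic form). -/
def IsTotallyIsotropic : ClassicalForm K V → Submodule K V → Prop
  | symplectic B _ _, W => ∀ x ∈ W, ∀ y ∈ W, B x y = 0
  | hermitian _ _ _ B _ _, W => ∀ x ∈ W, ∀ y ∈ W, B x y = 0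
  | orthogonal Q _, W => ∀ x ∈ W, Q x = 0

/-- The rank of the polar space, i.e. the Witt index of the form: the largest vector space
dimension of a totally isotropic (singular) subspace. -/
noncomputable def rank (f : ClassicalForm K V) : ℕ :=
  sSup {d : ℕ | ∃ W : Submodule K V, f.IsTotallyIsotropic W ∧ Module.finrank K W = d}

/-- A generator: an element of the polar space of maximal dimension. -/
def IsGenerator (f : ClassicalForm K V) (W : Submodule K V) : Prop :=
  f.IsTotallyIsotropic W ∧ Module.finrank K W = f.rank

/-- The points of the polar space: the totally isotropic (singular) points of the ambient
projective space. -/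
def points (f : ClassicalForm K V) : Set (Projectivization K V) :=
  {x | f.IsTotallyIsotropic x.submodule}

/-- An `m`-ovoid: a set of points of the polar space that meets every generator in exactly
`m` points. -/
def IsOvoid (f : ClassicalForm K V) (m : ℕ) (O : Set (Projectivization K V)) : Prop :=
  O ⊆ f.points ∧
    ∀ W : Submodule K V, f.IsGenerator W → {x ∈ O | x.submodule ≤ W}.ncard = m

end ClassicalForm

/-! Let `q = p ^ h` be the order of `K`, fix a point `x` of a `2`-ovoid `O`, and count the set `S`
of the other points of `O` orthogonal to `x`.

Lower bound (`pow_add_one_le_card`): let `G` be a generator on `x` and `y` the second point of `O`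
in `G`. Each of the `q ^ (r - 2)` hyperplanes of `G` through `x` but not `y` lies on another
generator, whose second point `z` of `O` satisfies `z^⊥ ∩ G = H`, where `H` is the hyperplane.
Distinct hyperplanes give distinct `z ≠ y`, so `|S| ≥ q ^ (r - 2) + 1`.

Upper bound (`card_le_choose`): distinct points of `S` are not orthogonal, since with `x` they would
put three points of `O` in one generator. So the Gram matrix of `S`, read in `x^⊥ / x` of dimension
at most `2r`, vanishes exactly on the diagonal. Its entrywise `(q - 1)`-th power is `J - I`, with
`J` the all-ones matrix, and has rank at most `(2r + p - 2).choose (p - 1) ^ h`.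

Together these force `p ^ (r - 2) ≤ (2r + p - 2).choose (p - 1)`, which fails in the given range. -/

/-! ### The rank bound, and zeros of ternary quadratic forms. -/

theorem Finset.sum_mul_pow_eq_sum_sym {R ι : Type*} [CommSemiring R] [Fintype ι] [DecidableEq ι]
    (c u : ι → R) (k : ℕ) :
    (∑ j, c j * u j) ^ k = ∑ m : Sym ι k,
      ((m.val.countPerms : R) * (m.val.map c).prod) * (m.val.map u).prod := by
  rw [Finset.sum_pow]
  simp only [Finset.sym_univ, Multiset.prod_map_mul, mul_assoc]

/-- All base-`p` digits of `p ^ h - 1` equal `p - 1`. In characteristic `p` the factors are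
Frobenius twists, so each expands into monomials of degree only `p - 1`. -/
theorem pow_pred_eq_prod_pow {M : Type*} [CommMonoid M] (a : M) (p h : ℕ) :
    a ^ (p ^ h - 1) = ∏ i : Fin h, (a ^ (p - 1)) ^ p ^ (i : ℕ) := by
  simp_rw [← pow_mul]
  rw [Finset.prod_pow_eq_pow_sum, ← Finset.mul_sum, Fin.sum_univ_eq_sum_range (fun i => p ^ i)]
  congr 1
  rw [mul_comm]
  rcases p with _ | p
  · rcases h with _ | h <;> simp
  · have := geom_sum_mul_add p h
    simp only [Nat.add_sub_cancel]
    omega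

/-- A family of vectors and functionals over a field with `p ^ h` elements whose incidence matrix
vanishes exactly on the diagonal has at most `(N + p - 2).choose (p - 1) ^ h + 1` members, where
`N` is the dimension. -/
theorem card_le_choose_pow_add_one {K U S : Type*} [Field K] [Fintype K] [AddCommGroup U]
    [Module K U] [FiniteDimensional K U] [Fintype S] (p h : ℕ) [Fact p.Prime] [CharP K p]
    (hq : Fintype.card K = p ^ h) (u : S → U) (φ : S → Module.Dual K U)
    (hφ : ∀ s t, φ s (u t) = 0 ↔ s = t) :
    Fintype.card S ≤ (Module.finrank K U + p - 2).choose (p - 1) ^ h + 1 := by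
  classical
  have hp : p.Prime := Fact.out
  set b := Module.finBasis K U
  set N := Module.finrank K U
  -- The spanning functions: the constant `1`, and products of Frobenius-twisted monomials of degree
  -- `p - 1`, one for each base-`p` digit.
  let F : Option (Fin h → Sym (Fin N) (p - 1)) → S → K := fun o t => match o with
    | none => 1
    | some m => ∏ i, (((m i).val.map fun j => b.repr (u t) j).prod) ^ p ^ (i : ℕ)
  have hF : ∀ o, F o ∈ Submodule.span K (Set.range F) := fun o => Submodule.subset_span ⟨o, rfl⟩
  have key : ∀ s, (fun t => φ s (u t) ^ (p ^ h - 1)) ∈ Submodule.span K (Set.range F) := by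
    intro s
    let c : (Fin h → Sym (Fin N) (p - 1)) → K := fun m => ∏ i,
      (((m i).val.countPerms : K) * ((m i).val.map fun j => φ s (b j)).prod) ^ p ^ (i : ℕ)
    have : (fun t => φ s (u t) ^ (p ^ h - 1)) = ∑ m, c m • F (some m) := by
      funext t
      have h1 : φ s (u t) = ∑ j, φ s (b j) * b.repr (u t) j := by
        conv_lhs => rw [← b.sum_repr (u t), map_sum]
        simp only [map_smul, smul_eq_mul, mul_comm]
      rw [pow_pred_eq_prod_pow, h1, Finset.sum_mul_pow_eq_sum_sym]
      simp only [sum_pow_char_pow, Finset.prod_univ_sum, Fintype.piFinset_univ, mul_pow]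
      rw [Finset.sum_apply]
      refine Finset.sum_congr rfl fun m _ => ?_
      simp only [c, F, Pi.smul_apply, smul_eq_mul, mul_pow, Finset.prod_mul_distrib]
    rw [this]
    exact Submodule.sum_mem _ fun m _ =>
      Submodule.smul_mem _ _ (hF (some m))
  have htop : Submodule.span K (Set.range F) = ⊤ := by
    rw [eq_top_iff, ← (Pi.basisFun K S).span_eq, Submodule.span_le]
    rintro _ ⟨s, rfl⟩
    -- Nonzero elements of `K` have `(q - 1)`-th power `1`, so this difference is the indicator of
    -- `s`.
    have : Pi.basisFun K S s = F none - fun t => φ s (u t) ^ (p ^ h - 1) := by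
      funext t
      have h1 : F none t = 1 := rfl
      rw [Pi.basisFun_apply, Pi.sub_apply, h1]
      have hpos : Fintype.card K - 1 ≠ 0 := by
        have := Fintype.one_lt_card (α := K)
        omega
      by_cases hst : s = t
      · subst hst
        rw [(hφ s s).2 rfl, ← hq, zero_pow hpos]
        simp
      · rw [← hq, FiniteField.pow_card_sub_one_eq_one _ (mt (hφ s t).1 hst)]
        simp [Ne.symm hst]
    rw [this]
    exact Submodule.sub_mem _ (hF none) (key s)
  have h1 := finrank_range_le_card (R := K) F
  rw [Set.finrank, htop, finrank_top, Module.finrank_fintype_fun_eq_card] at h1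
  have h2 : Fintype.card (Sym (Fin N) (p - 1)) = (N + p - 2).choose (p - 1) := by
    rw [Sym.card_sym_eq_choose, Fintype.card_fin]
    congr 1
    have := hp.two_le
    omega
  simpa [h2] using h1

/-- Chevalley–Warning: the degree `2` is less than the number `3` of variables. -/
theorem FiniteField.exists_ne_zero_ternary_eq_zero {F : Type*} [Field F] [Finite F]
    (a : Fin 3 → Fin 3 → F) :
    ∃ x : Fin 3 → F, x ≠ 0 ∧ ∑ i, ∑ j, a i j * (x i * x j) = 0 := by
  classical
  have := Fintype.ofFinite F
  obtain ⟨p, hp⟩ := CharP.exists F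
  have hpp : Fact p.Prime := ⟨CharP.char_is_prime F p⟩
  let f : MvPolynomial (Fin 3) F :=
    ∑ i, ∑ j, MvPolynomial.C (a i j) * (MvPolynomial.X i * MvPolynomial.X j)
  have hdeg : f.totalDegree < Fintype.card (Fin 3) := by
    refine lt_of_le_of_lt (b := 2) ?_ (by simp)
    refine MvPolynomial.totalDegree_finsetSum_le fun i _ =>
      MvPolynomial.totalDegree_finsetSum_le fun j _ => ?_
    refine (MvPolynomial.totalDegree_mul _ _).trans ?_
    have := MvPolynomial.totalDegree_mul (MvPolynomial.X i : MvPolynomial (Fin 3) F)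
      (MvPolynomial.X j)
    simp only [MvPolynomial.totalDegree_X, MvPolynomial.totalDegree_C] at this ⊢
    omega
  have hev : ∀ x, MvPolynomial.eval x f = ∑ i, ∑ j, a i j * (x i * x j) := by
    intro x; simp [f]
  have hdvd := char_dvd_card_solutions p hdeg
  have hz : MvPolynomial.eval (0 : Fin 3 → F) f = 0 := by rw [hev]; simp
  have hlt : 1 < Fintype.card { x : Fin 3 → F // MvPolynomial.eval x f = 0 } :=
    hpp.out.one_lt.trans_le (Nat.le_of_dvd (Fintype.card_pos_iff.2 ⟨⟨0, hz⟩⟩) hdvd)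
  obtain ⟨y, hy⟩ := Fintype.exists_ne_of_one_lt_card hlt ⟨0, hz⟩
  exact ⟨y.1, fun h => hy (Subtype.ext h), (hev _).symm.trans y.2⟩

/-! ### The binomial estimate. -/

/-- Passing from `r` to `r + 1` multiplies the binomial by `(2r + p)(2r + p - 1) / ((2r + 1)(2r))`,
which `hstep` bounds by `p`. -/
theorem choose_lt_pow_of_base {p r₀ : ℕ} (hp : 2 ≤ p) (hr₀ : 2 ≤ r₀)
    (hstep : ∀ r, r₀ ≤ r → (2 * r + p) * (2 * r + p - 1) ≤ p * ((2 * r + 1) * (2 * r)))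
    (hbase : (2 * r₀ + p - 2).choose (p - 1) < p ^ (r₀ - 2)) {r : ℕ} (hr : r₀ ≤ r) :
    (2 * r + p - 2).choose (p - 1) < p ^ (r - 2) := by
  induction r, hr using Nat.le_induction with
  | base => exact hbase
  | succ r hr ih =>
    obtain ⟨k, rfl⟩ : ∃ k, p = k + 2 := ⟨p - 2, by omega⟩
    have h0 := hstep r hr
    have e1 : 2 * (r + 1) + (k + 2) - 2 = 2 * r + k + 2 := by omega
    have e2 : 2 * r + (k + 2) - 2 = 2 * r + k := by omega
    have e3 : k + 2 - 1 = k + 1 := by omega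
    have e4 : r + 1 - 2 = r - 2 + 1 := by omega
    rw [e1, e3, e4, pow_succ]
    rw [e2, e3] at ih
    have h1 := Nat.choose_mul_succ_eq (2 * r + k) (k + 1)
    have h2 := Nat.choose_mul_succ_eq (2 * r + k + 1) (k + 1)
    have e5 : 2 * r + k + 1 - (k + 1) = 2 * r := by omega
    have e6 : 2 * r + k + 1 + 1 - (k + 1) = 2 * r + 1 := by omega
    have e7 : 2 * r + (k + 2) - 1 = 2 * r + k + 1 := by omega
    rw [e5] at h1
    rw [e6] at h2
    rw [e7] at h0
    have hpos : 0 < (2 * r + 1) * (2 * r) := by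
      have : 0 < r := by omega
      positivity
    refine lt_of_mul_lt_mul_right ?_ (Nat.zero_le ((2 * r + 1) * (2 * r)))
    calc (2 * r + k + 2).choose (k + 1) * ((2 * r + 1) * (2 * r))
        = (2 * r + k).choose (k + 1) * ((2 * r + (k + 2)) * (2 * r + k + 1)) := by
          rw [← mul_assoc, ← h2, mul_right_comm, ← h1]
          ring
      _ ≤ (2 * r + k).choose (k + 1) * ((k + 2) * ((2 * r + 1) * (2 * r))) := by gcongr
      _ < (k + 2) ^ (r - 2) * ((k + 2) * ((2 * r + 1) * (2 * r))) := by gcongr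
      _ = _ := by ring

theorem choose_lt_pow_of_rank_bound {p r : ℕ}
    (hr : (5 ≤ p ∧ p + 2 ≤ r) ∨ ((p = 2 ∨ p = 3) ∧ 6 ≤ r)) :
    (2 * r + p - 2).choose (p - 1) < p ^ (r - 2) := by
  rcases hr with ⟨hp5, hr⟩ | ⟨rfl | rfl, hr⟩
  · refine choose_lt_pow_of_base (by omega) (by omega) (fun s hs => ?_) ?_ hr
    · calc (2 * s + p) * (2 * s + p - 1) ≤ (3 * s) * (3 * s) := by gcongr <;> omega
        _ ≤ 5 * ((2 * s + 1) * (2 * s)) := by nlinarith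
        _ ≤ _ := by gcongr
    · have e1 : 2 * (p + 2) + p - 2 = 3 * p + 2 := by omega
      rw [e1, Nat.add_sub_cancel]
      -- From `p = 11` on, the crude bound `4 * 8 ^ p < 11 ^ p` suffices.
      by_cases h11 : 11 ≤ p
      · calc (3 * p + 2).choose (p - 1) ≤ 2 ^ (3 * p + 2) := Nat.choose_le_two_pow _ _
          _ = 4 * 8 ^ p := by rw [pow_add, pow_mul]; norm_num; ring
          _ < 11 ^ p := by
            induction p, h11 using Nat.le_induction with
            | base => norm_num
            | succ n hn ih =>
              have := ih (by omega) (by omega) (by omega)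
              rw [pow_succ, pow_succ]
              omega
          _ ≤ p ^ p := Nat.pow_le_pow_left h11 p
      · interval_cases p <;> decide
  -- At `r = 6` the inequality reads `12 < 16` for `p = 2` and `78 < 81` for `p = 3`; it fails at `r
  -- = 5`.
  · refine choose_lt_pow_of_base (by omega) (by omega) (fun s hs => ?_) (by decide) hr
    simp only [show 2 * s + 2 - 1 = 2 * s + 1 by omega]
    nlinarith
  · refine choose_lt_pow_of_base (by omega) (by omega) (fun s hs => ?_) (by decide) hr
    simp only [show 2 * s + 3 - 1 = 2 * s + 2 by omega]
    nlinarith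

/-! ### A common description of the three kinds of form. -/

namespace ClassicalForm

variable {K V : Type*} [Field K] [AddCommGroup V] [Module K V]

/-- The form `f` is presented by a reflexive sesquilinear form `β` together with a predicate
`sing` on vectors: an element of the polar space is a subspace consisting of pairwise
`β`-orthogonal vectors satisfying `sing`. -/
structure IsPresentedBy (f : ClassicalForm K V) (σ : K →+* K) (β : V →ₛₗ[σ] V →ₗ[K] K)
    (sing : V → Prop) : Prop where
  invol : ∀ a, σ (σ a) = a
  refl : ∀ x y, β x y = 0 → β y x = 0
  smul_sing : ∀ (a : K) x, sing x → sing (a • x)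
  add_sing : ∀ x y, sing x → sing y → β x y = 0 → sing (x + y)
  self_eq_zero : ∀ x, sing x → β x x = 0
  -- Restricted to singular `x`: in characteristic `2` the polar form of `Q` may have a nonzero
  -- radical.
  nondeg : ∀ x, sing x → (∀ y, β x y = 0) → x = 0
  exists_sing_add_smul : ∀ w u, sing w → β w u ≠ 0 → ∃ c : K, sing (u + c • w)
  exists_sing_ternary : ∀ v : Fin 3 → V, ∃ a : Fin 3 → K, a ≠ 0 ∧ sing (∑ i, a i • v i)
  isTotallyIsotropic_iff : ∀ W, f.IsTotallyIsotropic W ↔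
    (∀ x ∈ W, sing x) ∧ ∀ x ∈ W, ∀ y ∈ W, β x y = 0

theorem isPresentedBy_symplectic (B : LinearMap.BilinForm K V) (alt : B.IsAlt)
    (nondeg : B.Nondegenerate) :
    (symplectic B alt nondeg).IsPresentedBy (RingHom.id K) B fun _ => True where
  invol _ := rfl
  refl := alt.isRefl
  smul_sing _ _ _ := trivial
  add_sing _ _ _ _ _ := trivial
  self_eq_zero x _ := alt x
  nondeg x _ h := nondeg.1 x h
  exists_sing_add_smul _ _ _ _ := ⟨0, trivial⟩
  exists_sing_ternary _ := ⟨1, one_ne_zero, trivial⟩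
  isTotallyIsotropic_iff W := by simp [IsTotallyIsotropic]

theorem isPresentedBy_orthogonal [Finite K] (Q : QuadraticForm K V) (nondeg : Q.Nondegenerate) :
    (orthogonal Q nondeg).IsPresentedBy (RingHom.id K) Q.polarBilin fun x => Q x = 0 where
  invol _ := rfl
  refl x y h := by
    simpa [QuadraticMap.polar_comm] using h
  smul_sing a x h := by simp [QuadraticMap.map_smul, h]
  add_sing x y hx hy h := by
    rw [QuadraticMap.polarBilin_apply_apply] at h
    rw [QuadraticMap.map_add Q, hx, hy, h]; simp
  self_eq_zero x h := by simp [h]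
  nondeg x hx h := by
    have : x ∈ Q.radical := ⟨hx, LinearMap.ext h⟩
    rwa [nondeg.radical_eq_bot, Submodule.mem_bot] at this
  exists_sing_add_smul w u hw h := by
    rw [QuadraticMap.polarBilin_apply_apply] at h
    refine ⟨-Q u / QuadraticMap.polar Q w u, ?_⟩
    rw [QuadraticMap.map_add Q, QuadraticMap.map_smul, hw, QuadraticMap.polar_smul_right,
      QuadraticMap.polar_comm Q u w, smul_eq_mul, smul_eq_mul, div_mul_cancel₀ _ h]
    simp
  exists_sing_ternary v := by
    obtain ⟨x, hx, h⟩ := FiniteField.exists_ne_zero_ternary_eq_zero fun i j : Fin 3 =>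
      if i = j then Q (v i) else if i < j then QuadraticMap.polar Q (v i) (v j) else 0
    refine ⟨x, hx, Eq.trans ?_ h⟩
    simp only [Fin.sum_univ_three, QuadraticMap.map_add Q, QuadraticMap.map_smul,
      QuadraticMap.polar_smul_right, QuadraticMap.polar_smul_left, QuadraticMap.polar_add_left,
      smul_eq_mul]
    simp
    ring
  isTotallyIsotropic_iff W := by
    refine ⟨fun h => ⟨h, fun x hx y hy => ?_⟩, fun h => h.1⟩
    simp [QuadraticMap.polar, h x hx, h y hy, h _ (W.add_mem hx hy)]

theorem isPresentedBy_hermitian [Finite K] (σ : K →+* K) (invol : ∀ a, σ (σ a) = a)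
    (ne_id : σ ≠ RingHom.id K) (B : V →ₛₗ[σ] V →ₗ[K] K) (symm : B.IsSymm)
    (nondeg : B.Nondegenerate) :
    (hermitian σ invol ne_id B symm nondeg).IsPresentedBy σ B fun x => B x x = 0 where
  invol := invol
  refl := symm.isRefl
  smul_sing a x h := by simp [h]
  add_sing x y hx hy h := by simp [hx, hy, h, symm.isRefl x y h]
  self_eq_zero x h := h
  nondeg x _ h := nondeg.1 x h
  exists_sing_add_smul w u hw h := by
    -- If the trace vanished, `d = 1` would give characteristic `2`, and then `σ d = -d = d` for all
    -- `d`.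
    obtain ⟨d, hd⟩ : ∃ d, d + σ d ≠ 0 := by
      by_contra! hall
      refine ne_id (RingHom.ext fun d => ?_)
      have h1 := hall 1
      have h2 := hall d
      rw [map_one] at h1
      rw [RingHom.id_apply]
      linear_combination h2 - d * h1
    have hwu : B u w ≠ 0 := fun h' => h (symm.isRefl _ _ h')
    have huu : σ (B u u) = B u u := symm.eq u u
    -- Chosen so that `c * B u w` has trace `-B u u`.
    refine ⟨-(B u u * d) / (d + σ d) / B u w, ?_⟩
    simp only [map_add, LinearMap.add_apply, map_smul, LinearMap.map_smulₛₗ, LinearMap.smul_apply,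
      smul_eq_mul, hw, map_div₀, map_neg, map_mul, huu, symm.eq, invol]
    rw [add_comm (σ d) d]
    field_simp
    ring
  exists_sing_ternary v := by
    -- With coefficients in the fixed field of `σ`, the Hermitian form becomes a ternary quadratic
    -- form over that field.
    let F := σ.eqLocusField (RingHom.id K)
    have hF : ∀ a, a ∈ F ↔ σ a = a := fun a => Iff.rfl
    let a : Fin 3 → Fin 3 → F := fun i j =>
      if i = j then ⟨B (v i) (v i), symm.eq _ _⟩
      else if i < j then ⟨B (v i) (v j) + B (v j) (v i), by
        rw [hF, map_add, symm.eq, symm.eq, add_comm]⟩ else 0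
    obtain ⟨x, hx, h⟩ := FiniteField.exists_ne_zero_ternary_eq_zero a
    refine ⟨fun i => x i, fun h' => hx (funext fun i => Subtype.ext (congrFun h' i)), ?_⟩
    have h2 := congrArg (Subtype.val) h
    refine Eq.trans ?_ h2
    have hσ : ∀ i, σ (x i) = x i := fun i => (x i).2
    simp only [Fin.sum_univ_three, map_add, LinearMap.add_apply, map_smul, LinearMap.map_smulₛₗ,
      LinearMap.smul_apply, smul_eq_mul, hσ, a]
    simp
    ring
  isTotallyIsotropic_iff W := ⟨fun h => ⟨fun x hx => h x hx x hx, h⟩, fun h => h.2⟩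

theorem exists_isPresentedBy [Finite K] (f : ClassicalForm K V) :
    ∃ (σ : K →+* K) (β : V →ₛₗ[σ] V →ₗ[K] K) (sing : V → Prop), f.IsPresentedBy σ β sing := by
  cases f with
  | symplectic B alt nondeg => exact ⟨_, _, _, isPresentedBy_symplectic B alt nondeg⟩
  | hermitian σ invol ne_id B symm nondeg =>
    exact ⟨_, _, _, isPresentedBy_hermitian σ invol ne_id B symm nondeg⟩
  | orthogonal Q nondeg => exact ⟨_, _, _, isPresentedBy_orthogonal Q nondeg⟩

end ClassicalForm

/-! ### Generators, and the dimension of the ambient space. -/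

theorem Submodule.finrank_le_finrank_inf_ker_add_one
    {K V : Type*} [Field K] [AddCommGroup V] [Module K V] [FiniteDimensional K V]
    (G : Submodule K V) (φ : Module.Dual K V) :
    Module.finrank K G ≤ Module.finrank K (G ⊓ LinearMap.ker φ : Submodule K V) + 1 := by
  have h1 := Submodule.finrank_sup_add_finrank_inf_eq G (LinearMap.ker φ)
  have h2 := LinearMap.finrank_range_add_finrank_ker φ
  have h3 := Submodule.finrank_le (LinearMap.range φ)
  have h4 := Submodule.finrank_le (G ⊔ LinearMap.ker φ)
  rw [Module.finrank_self] at h3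
  omega

namespace ClassicalForm

variable {K V : Type*} [Field K] [AddCommGroup V] [Module K V] [FiniteDimensional K V]

section Rank

variable (f : ClassicalForm K V)

theorem bddAbove_finrank :
    BddAbove {d : ℕ | ∃ W : Submodule K V, f.IsTotallyIsotropic W ∧ Module.finrank K W = d} :=
  ⟨Module.finrank K V, by rintro _ ⟨W, _, rfl⟩; exact Submodule.finrank_le W⟩

variable {f} in
theorem IsTotallyIsotropic.finrank_le_rank {W : Submodule K V} (hW : f.IsTotallyIsotropic W) :
    Module.finrank K W ≤ f.rank :=
  le_csSup f.bddAbove_finrank ⟨W, hW, rfl⟩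

theorem exists_isGenerator : ∃ W, f.IsGenerator W := by
  have hbot : f.IsTotallyIsotropic ⊥ := by
    cases f <;> simp [IsTotallyIsotropic]
  have hne : {d : ℕ | ∃ W : Submodule K V, f.IsTotallyIsotropic W ∧
      Module.finrank K W = d}.Nonempty := ⟨_, ⊥, hbot, rfl⟩
  exact Nat.sSup_mem hne f.bddAbove_finrank

end Rank

omit [FiniteDimensional K V] in
theorem IsTotallyIsotropic.mono {W W' : Submodule K V}
    {f : ClassicalForm K V} (hW : f.IsTotallyIsotropic W) (hle : W' ≤ W) : f.IsTotallyIsotropic W' := by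
  cases f
  · exact fun x hx y hy => hW x (hle hx) y (hle hy)
  · exact fun x hx y hy => hW x (hle hx) y (hle hy)
  · exact fun x hx => hW x (hle hx)

namespace IsPresentedBy

variable {f : ClassicalForm K V} {σ : K →+* K} {β : V →ₛₗ[σ] V →ₗ[K] K} {sing : V → Prop}
  (h : f.IsPresentedBy σ β sing)

include h

omit [FiniteDimensional K V] in
theorem ringHomSurjective : RingHomSurjective σ := ⟨fun a => ⟨σ a, h.invol a⟩⟩

omit [FiniteDimensional K V] in
theorem sup_span_singleton {W : Submodule K V} (hW : f.IsTotallyIsotropic W) {v : V}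
    (hv : sing v) (hvW : ∀ w ∈ W, β w v = 0) :
    f.IsTotallyIsotropic (W ⊔ Submodule.span K {v}) := by
  rw [h.isTotallyIsotropic_iff] at hW ⊢
  refine ⟨fun x hx => ?_, fun x hx y hy => ?_⟩
  · obtain ⟨a, ha, b, hb, rfl⟩ := Submodule.mem_sup.1 hx
    obtain ⟨c, rfl⟩ := Submodule.mem_span_singleton.1 hb
    exact h.add_sing _ _ (hW.1 a ha) (h.smul_sing _ _ hv) (by simp [hvW a ha])
  · obtain ⟨a, ha, b, hb, rfl⟩ := Submodule.mem_sup.1 hx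
    obtain ⟨c, rfl⟩ := Submodule.mem_span_singleton.1 hb
    obtain ⟨a', ha', b', hb', rfl⟩ := Submodule.mem_sup.1 hy
    obtain ⟨c', rfl⟩ := Submodule.mem_span_singleton.1 hb'
    simp [hvW a ha, h.refl _ _ (hvW a' ha'), hW.2 a ha a' ha', h.self_eq_zero v hv]

theorem mem_of_isGenerator {G : Submodule K V} (hG : f.IsGenerator G) {v : V}
    (hv : sing v) (hvG : ∀ g ∈ G, β g v = 0) : v ∈ G := by
  by_contra hnot
  have h1 := (h.sup_span_singleton hG.1 hv hvG).finrank_le_rank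
  have h2 : G < G ⊔ Submodule.span K {v} := by
    refine lt_of_le_not_ge le_sup_left fun hle => hnot (hle ?_)
    exact Submodule.mem_sup_right (Submodule.mem_span_singleton_self v)
  have := Submodule.finrank_lt_finrank_of_lt h2
  rw [hG.2] at this
  omega

theorem isGenerator_sup_span_singleton {H : Submodule K V} (hH : f.IsTotallyIsotropic H)
    (hdim : f.rank ≤ Module.finrank K H + 1) {v : V} (hv : sing v) (hvH : ∀ w ∈ H, β w v = 0)
    (hnot : v ∉ H) : f.IsGenerator (H ⊔ Submodule.span K {v}) := by
  have h0 := h.sup_span_singleton hH hv hvH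
  refine ⟨h0, le_antisymm h0.finrank_le_rank (hdim.trans ?_)⟩
  refine Submodule.finrank_lt_finrank_of_lt (lt_of_le_not_ge le_sup_left fun hle => hnot (hle ?_))
  exact Submodule.mem_sup_right (Submodule.mem_span_singleton_self v)

/-- Exchange: for `w ∈ W` outside a generator `G`, the generator `⟨G ∩ w^⊥, w⟩` meets `W` in a
larger subspace. The induction is on the missing dimension `n`. -/
theorem exists_isGenerator_ge {W : Submodule K V} (hW : f.IsTotallyIsotropic W) :
    ∃ G, f.IsGenerator G ∧ W ≤ G := by
  suffices H : ∀ (n : ℕ) (G : Submodule K V), f.IsGenerator G →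
      Module.finrank K W ≤ Module.finrank K (W ⊓ G : Submodule K V) + n →
      ∃ G, f.IsGenerator G ∧ W ≤ G by
    obtain ⟨G, hG⟩ := f.exists_isGenerator
    exact H (Module.finrank K W) G hG (by omega)
  intro n
  induction n with
  | zero =>
    intro G hG hle
    refine ⟨G, hG, inf_eq_left.1 (Submodule.eq_of_le_of_finrank_le inf_le_left ?_)⟩
    simpa using hle
  | succ n ih =>
    intro G hG hle
    by_cases hWG : W ≤ G
    · exact ⟨G, hG, hWG⟩
    obtain ⟨w, hwW, hwG⟩ := Set.not_subset.1 hWG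
    have hW' := (h.isTotallyIsotropic_iff W).1 hW
    have hgen : f.IsGenerator ((G ⊓ LinearMap.ker (β w)) ⊔ Submodule.span K {w}) := by
      refine h.isGenerator_sup_span_singleton (hG.1.mono inf_le_left) ?_ (hW'.1 w hwW) ?_ ?_
      · rw [← hG.2]
        exact Submodule.finrank_le_finrank_inf_ker_add_one G (β w)
      · exact fun g hg => h.refl _ _ hg.2
      · exact fun hw => hwG hw.1
    refine ih _ hgen ?_
    have hlt : W ⊓ G < W ⊓ ((G ⊓ LinearMap.ker (β w)) ⊔ Submodule.span K {w}) := by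
      refine lt_of_le_not_ge (le_inf inf_le_left ?_) fun hle' => ?_
      · exact fun g hg => Submodule.mem_sup_left ⟨hg.2, hW'.2 w hwW g hg.1⟩
      · exact hwG (hle' ⟨hwW, Submodule.mem_sup_right (Submodule.mem_span_singleton_self w)⟩).2
    have := Submodule.finrank_lt_finrank_of_lt hlt
    omega

/-- Otherwise biduality gives `β w = β y` for some `y ∈ H`, and the singular vector `w - y` lies in
the radical, hence is zero. -/
theorem exists_orthogonal_apply_ne_zero {G H : Submodule K V} (hG : f.IsTotallyIsotropic G)
    (hHG : H ≤ G) {w : V} (hw : w ∈ G) (hwH : w ∉ H) :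
    ∃ u, (∀ y ∈ H, β y u = 0) ∧ β w u ≠ 0 := by
  have := h.ringHomSurjective
  by_contra! hall
  have hmem : β w ∈ ((H.map β).dualCoannihilator).dualAnnihilator := by
    rw [Submodule.mem_dualAnnihilator]
    intro u hu
    rw [Submodule.mem_dualCoannihilator] at hu
    exact hall u fun y hy => hu _ (Submodule.mem_map_of_mem hy)
  rw [Subspace.dualCoannihilator_dualAnnihilator_eq] at hmem
  obtain ⟨y, hy, hyw⟩ := hmem
  have hzero : w - y = 0 := by
    refine h.nondeg _ (((h.isTotallyIsotropic_iff G).1 hG).1 _ (G.sub_mem hw (hHG hy))) fun z => ?_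
    rw [map_sub, hyw, sub_self, LinearMap.zero_apply]
  rw [sub_eq_zero] at hzero
  exact hwH (hzero ▸ hy)

/-- A hyperplane of a generator lies on a second generator. -/
theorem exists_isGenerator_of_hyperplane {G H : Submodule K V} (hG : f.IsGenerator G)
    (hHG : H ≤ G) (hdim : f.rank ≤ Module.finrank K H + 1) {w : V} (hw : w ∈ G) (hwH : w ∉ H) :
    ∃ G', f.IsGenerator G' ∧ H ≤ G' ∧ w ∉ G' := by
  obtain ⟨hGs, hGo⟩ := (h.isTotallyIsotropic_iff G).1 hG.1
  obtain ⟨u, hu, hwu⟩ := h.exists_orthogonal_apply_ne_zero hG.1 hHG hw hwH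
  -- Adding a multiple of `w ∈ G` makes `u` singular without changing its products with `w` and `H`.
  obtain ⟨c, hc⟩ := h.exists_sing_add_smul w u (hGs w hw) hwu
  have hwv : β w (u + c • w) ≠ 0 := by simpa [hGo w hw w hw] using hwu
  have hgen : f.IsGenerator (H ⊔ Submodule.span K {u + c • w}) := by
    refine h.isGenerator_sup_span_singleton (hG.1.mono hHG) hdim hc ?_ ?_
    · intro y hy
      simp [hu y hy, hGo y (hHG hy) w hw]
    · exact fun hmem => hwv (hGo w hw _ (hHG hmem))
  refine ⟨_, hgen, le_sup_left, fun hmem => hwv ?_⟩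
  exact ((h.isTotallyIsotropic_iff _).1 hgen.1).2 w hmem _
    (Submodule.mem_sup_right (Submodule.mem_span_singleton_self _))

/-- `G^⊥` has codimension at most `r`. Were its image modulo `G` of dimension at least `3`, a
ternary zero would give a singular vector of `G^⊥` outside `G`, against maximality. -/
theorem finrank_le_two_mul_rank_add_two : Module.finrank K V ≤ 2 * f.rank + 2 := by
  have := h.ringHomSurjective
  obtain ⟨G, hG⟩ := f.exists_isGenerator
  let Φ : Submodule K (Module.Dual K V) := G.map β
  let P := Φ.dualCoannihilator
  have hPmem : ∀ u ∈ P, ∀ g ∈ G, β g u = 0 := fun u hu g hg =>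
    (Submodule.mem_dualCoannihilator _).1 hu _ (Submodule.mem_map_of_mem hg)
  have h1 := Subspace.finrank_add_finrank_dualCoannihilator_eq Φ
  change _ + Module.finrank K P = _ at h1
  have h2 : Module.finrank K Φ ≤ f.rank := by
    change Module.finrank K (G.map β) ≤ _
    have hspan : G = Submodule.span K (Set.range fun i => (Module.finBasis K G i : V)) := by
      conv_lhs => rw [← Submodule.range_subtype G, ← Submodule.map_top,
        ← (Module.finBasis K G).span_eq, Submodule.map_span, ← Set.range_comp]
      rfl
    rw [hspan, Submodule.map_span, ← Set.range_comp]
    refine (finrank_range_le_card _).trans ?_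
    rw [Fintype.card_fin, hG.2]
  by_contra! hlt
  have hquot : 3 ≤ Module.finrank K (P.map G.mkQ) := by
    have h3 := LinearMap.finrank_range_add_finrank_ker (G.mkQ.domRestrict P)
    have h4 : Module.finrank K (LinearMap.ker (G.mkQ.domRestrict P)) ≤ f.rank := by
      rw [← hG.2]
      refine LinearMap.finrank_le_finrank_of_injective
        (f := LinearMap.codRestrict G (P.subtype ∘ₗ (Submodule.subtype _)) fun x => ?_) ?_
      · exact (Submodule.Quotient.mk_eq_zero G).1 x.2
      · intro x y hxy
        exact Subtype.ext (Subtype.ext (congrArg (Subtype.val : G → V) hxy))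
    rw [LinearMap.range_domRestrict] at h3
    omega
  obtain ⟨v, hv⟩ : ∃ v : Fin 3 → P.map G.mkQ, LinearIndependent K v :=
    exists_linearIndependent_of_le_finrank hquot
  choose u huP huv using fun i => (v i).2
  obtain ⟨a, ha, hs⟩ := h.exists_sing_ternary u
  have hmem : ∑ i, a i • u i ∈ G := by
    refine h.mem_of_isGenerator hG hs fun g hg => ?_
    rw [map_sum]
    refine Finset.sum_eq_zero fun i _ => ?_
    rw [map_smul, hPmem _ (huP i) g hg, smul_zero]
  refine ha (funext (Fintype.linearIndependent_iff.1 hv a (Subtype.ext ?_)))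
  have h5 : G.mkQ (∑ i, a i • u i) = 0 := (Submodule.Quotient.mk_eq_zero G).2 hmem
  rw [map_sum] at h5
  simpa [huv] using h5

end IsPresentedBy

end ClassicalForm

/-! ### Points of a `2`-ovoid orthogonal to a given one. -/

namespace Projectivization

variable {K V : Type*} [Field K] [AddCommGroup V] [Module K V]

theorem submodule_le_iff_rep_mem (y : Projectivization K V) (W : Submodule K V) :
    y.submodule ≤ W ↔ y.rep ∈ W := by
  rw [submodule_eq, Submodule.span_singleton_le_iff_mem]

theorem eq_of_rep_mem_span {y z : Projectivization K V} (h : y.rep ∈ Submodule.span K {z.rep}) :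
    y = z := by
  rw [← submodule_eq, ← submodule_le_iff_rep_mem] at h
  refine submodule_injective (Submodule.eq_of_le_of_finrank_le h ?_)
  rw [finrank_submodule, finrank_submodule]

end Projectivization

namespace ClassicalForm

variable {K V : Type*} [Field K] [AddCommGroup V] [Module K V]

theorem IsOvoid.exists_second_point {f : ClassicalForm K V} {O : Set (Projectivization K V)}
    (hO : f.IsOvoid 2 O) {G : Submodule K V} (hG : f.IsGenerator G) {x : Projectivization K V}
    (hx : x ∈ O) (hxG : x.rep ∈ G) :
    ∃ y ∈ O, y ≠ x ∧ y.rep ∈ G ∧ ∀ z ∈ O, z.rep ∈ G → z = x ∨ z = y := by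
  obtain ⟨a, b, hab, hset⟩ := Set.ncard_eq_two.1 (hO.2 G hG)
  simp only [Projectivization.submodule_le_iff_rep_mem, Set.ext_iff, Set.mem_ofPred_eq,
    Set.mem_insert_iff, Set.mem_singleton_iff] at hset
  have ha := (hset a).2 (Or.inl rfl)
  have hb := (hset b).2 (Or.inr rfl)
  rcases (hset x).1 ⟨hx, hxG⟩ with rfl | rfl
  · exact ⟨b, hb.1, hab.symm, hb.2, fun z hz hzG => (hset z).1 ⟨hz, hzG⟩⟩
  · exact ⟨a, ha.1, hab, ha.2, fun z hz hzG => ((hset z).1 ⟨hz, hzG⟩).symm⟩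

namespace IsPresentedBy

variable {f : ClassicalForm K V} {σ : K →+* K} {β : V →ₛₗ[σ] V →ₗ[K] K} {sing : V → Prop}
  (h : f.IsPresentedBy σ β sing) {O : Set (Projectivization K V)}

include h

theorem sing_rep {x : Projectivization K V} (hx : x ∈ f.points) : sing x.rep :=
  ((h.isTotallyIsotropic_iff _).1 hx).1 _
    ((Projectivization.submodule_le_iff_rep_mem x x.submodule).1 le_rfl)

variable [FiniteDimensional K V]

theorem not_orthogonal_triple (hO : f.IsOvoid 2 O) {x y z : Projectivization K V}
    (hx : x ∈ O) (hy : y ∈ O) (hz : z ∈ O) (hyx : y ≠ x) (hzx : z ≠ x) (hyz : y ≠ z)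
    (hxy : β x.rep y.rep = 0) (hxz : β x.rep z.rep = 0) : β y.rep z.rep ≠ 0 := by
  intro hβ
  have hW : f.IsTotallyIsotropic
      (x.submodule ⊔ Submodule.span K {y.rep} ⊔ Submodule.span K {z.rep}) := by
    refine h.sup_span_singleton (h.sup_span_singleton (hO.1 hx) (h.sing_rep (hO.1 hy)) ?_)
      (h.sing_rep (hO.1 hz)) ?_
    · intro w hw
      rw [Projectivization.submodule_eq] at hw
      obtain ⟨a, rfl⟩ := Submodule.mem_span_singleton.1 hw
      simp [hxy]
    · intro w hw
      obtain ⟨w₁, hw₁, w₂, hw₂, rfl⟩ := Submodule.mem_sup.1 hw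
      rw [Projectivization.submodule_eq] at hw₁
      obtain ⟨a, rfl⟩ := Submodule.mem_span_singleton.1 hw₁
      obtain ⟨b, rfl⟩ := Submodule.mem_span_singleton.1 hw₂
      simp [hxz, hβ]
  obtain ⟨G, hG, hle⟩ := h.exists_isGenerator_ge hW
  have hxG : x.rep ∈ G :=
    (Projectivization.submodule_le_iff_rep_mem x G).1 ((le_sup_left.trans le_sup_left).trans hle)
  have hyG : y.rep ∈ G := hle (Submodule.mem_sup_left (Submodule.mem_sup_right
    (Submodule.mem_span_singleton_self _)))
  have hzG : z.rep ∈ G := hle (Submodule.mem_sup_right (Submodule.mem_span_singleton_self _))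
  obtain ⟨w, -, -, -, hw⟩ := hO.exists_second_point hG hx hxG
  exact hyz (((hw y hy hyG).resolve_left hyx).trans ((hw z hz hzG).resolve_left hzx).symm)

/-- A hyperplane of a generator that contains exactly one of the two points `x`, `y` of the
`2`-ovoid in it, namely `x`, is cut out by a further point of the `2`-ovoid orthogonal to `x`. -/
theorem exists_point_of_hyperplane (hO : f.IsOvoid 2 O) {G : Submodule K V}
    (hG : f.IsGenerator G) {x y : Projectivization K V} (hx : x ∈ O) (hxG : x.rep ∈ G)
    (hyG : y.rep ∈ G) (huniq : ∀ z ∈ O, z.rep ∈ G → z = x ∨ z = y) (ψ : Module.Dual K G)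
    (hψx : ψ ⟨x.rep, hxG⟩ = 0) (hψy : ψ ⟨y.rep, hyG⟩ = 1) :
    ∃ z ∈ O, z ≠ x ∧ β x.rep z.rep = 0 ∧ ∀ g : G, β z.rep g = 0 ↔ ψ g = 0 := by
  set H : Submodule K V := (LinearMap.ker ψ).map G.subtype with hH
  have hHmem : ∀ g : G, ψ g = 0 → (g : V) ∈ H := fun g hg => ⟨g, hg, rfl⟩
  have hdim : f.rank ≤ Module.finrank K H + 1 := by
    rw [hH, (Submodule.equivSubtypeMap G (LinearMap.ker ψ)).symm.finrank_eq, ← hG.2]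
    have h1 := LinearMap.finrank_range_add_finrank_ker ψ
    have h2 := Submodule.finrank_le (LinearMap.range ψ)
    rw [Module.finrank_self] at h2
    omega
  have hyH : y.rep ∉ H := by
    rintro ⟨g, hg, hgy⟩
    have : g = ⟨y.rep, hyG⟩ := Subtype.ext hgy
    rw [this] at hg
    exact one_ne_zero (hψy.symm.trans hg)
  obtain ⟨G', hG', hHG', hyG'⟩ :=
    h.exists_isGenerator_of_hyperplane hG (Submodule.map_subtype_le _ _) hdim hyG hyH
  have hxG' : x.rep ∈ G' := hHG' (hHmem _ hψx)
  obtain ⟨z, hz, hzx, hzG', -⟩ := hO.exists_second_point hG' hx hxG'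
  have hort := ((h.isTotallyIsotropic_iff _).1 hG'.1).2
  refine ⟨z, hz, hzx, hort _ hxG' _ hzG', fun g => ⟨fun hzg => ?_, fun hg =>
    hort _ hzG' _ (hHG' (hHmem g hg))⟩⟩
  by_contra hψg
  -- Being orthogonal to `H` and to some `g` outside it, `z` is orthogonal to all of `G`, hence lies
  -- in `G` by maximality.
  have hzG : z.rep ∈ G := by
    refine h.mem_of_isGenerator hG (h.sing_rep (hO.1 hz)) fun g' hg' => h.refl _ _ ?_
    have h1 : ψ (⟨g', hg'⟩ - (ψ ⟨g', hg'⟩ / ψ g) • g) = 0 := by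
      rw [map_sub, map_smul, smul_eq_mul, div_mul_cancel₀ _ hψg, sub_self]
    have h2 := hort _ hzG' _ (hHG' (hHmem _ h1))
    simpa [hzg] using h2
  rcases huniq z hz hzG with rfl | rfl
  · exact hzx rfl
  · exact hyG' hzG'

theorem pow_add_one_le_card [Finite K] (hO : f.IsOvoid 2 O) {x : Projectivization K V}
    (hx : x ∈ O) :
    Nat.card K ^ (f.rank - 2) + 1 ≤
      Nat.card {z // z ∈ O ∧ z ≠ x ∧ β x.rep z.rep = 0} := by
  have : Finite V := Module.finite_of_finite K
  obtain ⟨G, hG, hxG'⟩ := h.exists_isGenerator_ge (hO.1 hx)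
  have hxG := (Projectivization.submodule_le_iff_rep_mem x G).1 hxG'
  obtain ⟨y, hy, hyx, hyG, huniq⟩ := hO.exists_second_point hG hx hxG
  have hort := ((h.isTotallyIsotropic_iff _).1 hG.1).2
  obtain ⟨ψ, hψx, hψy⟩ : ∃ ψ : Module.Dual K G,
      ψ ⟨x.rep, hxG⟩ = 0 ∧ ψ ⟨y.rep, hyG⟩ = 1 := by
    have hnot : (⟨y.rep, hyG⟩ : G) ∉ Submodule.span K {(⟨x.rep, hxG⟩ : G)} := by
      intro hmem
      obtain ⟨a, ha⟩ := Submodule.mem_span_singleton.1 hmem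
      exact hyx (Projectivization.eq_of_rep_mem_span
        (Submodule.mem_span_singleton.2 ⟨a, congrArg Subtype.val ha⟩))
    rw [← Subspace.forall_mem_dualAnnihilator_apply_eq_zero_iff] at hnot
    push Not at hnot
    obtain ⟨φ, hφ, hφy⟩ := hnot
    refine ⟨(φ ⟨y.rep, hyG⟩)⁻¹ • φ, ?_, ?_⟩
    · rw [LinearMap.smul_apply, (Submodule.mem_dualAnnihilator φ).1 hφ _
        (Submodule.mem_span_singleton_self _), smul_zero]
    · rw [LinearMap.smul_apply, smul_eq_mul, inv_mul_cancel₀ hφy]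
  let L : Submodule K G := Submodule.span K {⟨x.rep, hxG⟩, ⟨y.rep, hyG⟩}
  -- The translates `ψ + t` are the functionals with value `0` at `x` and `1` at `y`: exactly one
  -- for each hyperplane through `x` missing `y`.
  let T : Submodule K (Module.Dual K G) := L.dualAnnihilator
  have hTx : ∀ t : T, (ψ + t.1) ⟨x.rep, hxG⟩ = 0 := fun t => by
    rw [LinearMap.add_apply, hψx, (Submodule.mem_dualAnnihilator t.1).1 t.2 _
      (Submodule.subset_span (by simp)), add_zero]
  have hTy : ∀ t : T, (ψ + t.1) ⟨y.rep, hyG⟩ = 1 := fun t => by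
    rw [LinearMap.add_apply, hψy, (Submodule.mem_dualAnnihilator t.1).1 t.2 _
      (Submodule.subset_span (by simp)), add_zero]
  have hTdim : f.rank - 2 ≤ Module.finrank K T := by
    have h1 : Module.finrank K L + Module.finrank K T = Module.finrank K G :=
      Subspace.finrank_add_finrank_dualAnnihilator_eq L
    have h2 : Module.finrank K L ≤ 2 := by
      classical
      have := finrank_span_finset_le_card (R := K)
        ({⟨x.rep, hxG⟩, ⟨y.rep, hyG⟩} : Finset G)
      rw [Set.finrank, Finset.coe_pair] at this
      exact this.trans Finset.card_le_two
    rw [← hG.2]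
    omega
  choose z hzO hzx hzort hz using fun t : T =>
    h.exists_point_of_hyperplane hO hG hx hxG hyG huniq (ψ + t.1) (hTx t) (hTy t)
  have hzy : ∀ t, z t ≠ y := by
    intro t hty
    have h1 := (hz t ⟨y.rep, hyG⟩).1 (by rw [hty]; exact hort _ hyG _ hyG)
    exact one_ne_zero ((hTy t).symm.trans h1)
  have hinj : Function.Injective z := by
    intro s t hst
    refine Subtype.ext (add_left_cancel (a := ψ) (LinearMap.ext fun g => ?_))
    have h1 : (ψ + s.1) (g - (ψ + s.1) g • ⟨y.rep, hyG⟩) = 0 := by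
      rw [map_sub, map_smul, hTy, smul_eq_mul, mul_one, sub_self]
    have h2 := (hz t _).1 (hst ▸ (hz s _).2 h1)
    rw [map_sub, map_smul, hTy, smul_eq_mul, mul_one, sub_eq_zero] at h2
    exact h2.symm
  -- The extra element `none` counts `y` itself.
  let F : Option T → {z // z ∈ O ∧ z ≠ x ∧ β x.rep z.rep = 0} := fun o =>
    o.elim ⟨y, hy, hyx, hort _ hxG _ hyG⟩ fun t => ⟨z t, hzO t, hzx t, hzort t⟩
  have hF : Function.Injective F := by
    rintro (_ | s) (_ | t) hst
    · rfl
    · exact (hzy t (congrArg Subtype.val hst).symm).elim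
    · exact (hzy s (congrArg Subtype.val hst)).elim
    · exact congrArg some (hinj (congrArg Subtype.val hst))
  have hcard := Nat.card_le_card_of_injective F hF
  have : Finite T := Module.finite_of_finite K
  rw [Finite.card_option, Module.natCard_eq_pow_finrank (K := K) (V := T)] at hcard
  refine le_trans (Nat.succ_le_succ (Nat.pow_le_pow_right Nat.card_pos hTdim)) hcard

theorem card_le_choose [Finite K] (p : ℕ) [Fact p.Prime] [CharP K p] {n : ℕ}
    (hq : Nat.card K = p ^ n) (hO : f.IsOvoid 2 O) {x : Projectivization K V} (hx : x ∈ O) :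
    Nat.card {z // z ∈ O ∧ z ≠ x ∧ β x.rep z.rep = 0} ≤
      (2 * f.rank + p - 2).choose (p - 1) ^ n + 1 := by
  have : Finite V := Module.finite_of_finite K
  have := Fintype.ofFinite K
  have := Fintype.ofFinite {z // z ∈ O ∧ z ≠ x ∧ β x.rep z.rep = 0}
  have hxs := h.sing_rep (hO.1 hx)
  let M : Submodule K V := LinearMap.ker (β x.rep)
  let x' : M := ⟨x.rep, h.self_eq_zero _ hxs⟩
  let L : Submodule K M := Submodule.span K {x'}
  have hkill : ∀ v : V, β x.rep v = 0 → L ≤ LinearMap.ker ((β v).domRestrict M) := fun v hv => by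
    rw [Submodule.span_singleton_le_iff_mem]
    exact h.refl _ _ hv
  -- Passing to `x^⊥ / x` lowers the dimension by two, since `x` is not in the radical.
  have hdim : Module.finrank K (M ⧸ L) ≤ 2 * f.rank := by
    have h1 := h.finrank_le_two_mul_rank_add_two
    have h2 := Submodule.finrank_quotient_add_finrank L
    have h3 : Module.finrank K L = 1 := finrank_span_singleton fun h0 =>
      x.rep_nonzero (congrArg Subtype.val h0)
    have h4 : M < ⊤ := by
      rw [lt_top_iff_ne_top]
      intro htop
      exact x.rep_nonzero (h.nondeg _ hxs fun y => (htop ▸ Submodule.mem_top : y ∈ M))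
    have h5 := Submodule.finrank_lt h4.ne
    omega
  have key := card_le_choose_pow_add_one (U := M ⧸ L) p n (Nat.card_eq_fintype_card.symm.trans hq)
    (fun z : {z // z ∈ O ∧ z ≠ x ∧ β x.rep z.rep = 0} => L.mkQ ⟨z.1.rep, z.2.2.2⟩)
    (fun z => L.liftQ ((β z.1.rep).domRestrict M) (hkill _ z.2.2.2)) fun s t => by
      change β s.1.rep t.1.rep = 0 ↔ s = t
      constructor
      · intro hst
        by_contra hne
        exact h.not_orthogonal_triple hO hx s.2.1 t.2.1 s.2.2.1 t.2.2.1
          (fun h' => hne (Subtype.ext h')) s.2.2.2 t.2.2.2 hst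
      · rintro rfl
        exact h.self_eq_zero _ (h.sing_rep (hO.1 s.2.1))
  rw [Nat.card_eq_fintype_card]
  refine key.trans ?_
  gcongr

end IsPresentedBy

end ClassicalForm

/-! ### Comparison of the two bounds. -/

theorem corollary4p5 {K V : Type*} [Field K] [Finite K] [AddCommGroup V] [Module K V]
    [FiniteDimensional K V] (p : ℕ) [CharP K p] (f : ClassicalForm K V) (r : ℕ)
    (hrank : f.rank = r)
    (hr : (5 ≤ p ∧ (1 + Real.logb (p : ℝ) 7) * (p : ℝ) + 1 ≤ (r : ℝ)) ∨
      ((p = 2 ∨ p = 3) ∧ 6 ≤ r)) :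
    ¬ ∃ O : Set (Projectivization K V), f.IsOvoid 2 O := by
  rintro ⟨O, hO⟩
  have hp : p.Prime := CharP.char_is_prime K p
  have : Fact p.Prime := ⟨hp⟩
  have := Fintype.ofFinite K
  obtain ⟨n, -, hcard⟩ := FiniteField.card K p
  have hcard' : Nat.card K = p ^ (n : ℕ) := Nat.card_eq_fintype_card.trans hcard
  obtain ⟨σ, β, sing, h⟩ := f.exists_isPresentedBy
  obtain ⟨G, hG⟩ := f.exists_isGenerator
  obtain ⟨x, _, -, hset⟩ := Set.ncard_eq_two.1 (hO.2 G hG)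
  have hx : x ∈ O := (hset.symm ▸ Set.mem_insert x _ : x ∈ {x ∈ O | x.submodule ≤ G}).1
  have hbound : (2 * r + p - 2).choose (p - 1) < p ^ (r - 2) := by
    refine choose_lt_pow_of_rank_bound (hr.imp_left fun ⟨hp5, hle⟩ => ⟨hp5, ?_⟩)
    have hp1 : (1 : ℝ) < p := by exact_mod_cast hp.one_lt
    -- Positivity of the logarithm already gives `r > p + 1`, that is, `r ≥ p + 2`.
    have hpos : 0 < Real.logb p 7 * p :=
      mul_pos (Real.logb_pos hp1 (by norm_num)) (by linarith)
    have : ((p + 1 : ℕ) : ℝ) < r := by push_cast; linarith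
    exact_mod_cast this
  have h1 := (h.pow_add_one_le_card hO hx).trans (h.card_le_choose p hcard' hO hx)
  rw [hrank, hcard', ← pow_mul, mul_comm, pow_mul] at h1
  exact (Nat.pow_lt_pow_left hbound n.ne_zero).not_ge (Nat.le_of_succ_le_succ h1)
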